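/- Let $I=(0,l)$ with $0<l\le\infty$, let $1\le p<\infty$, and let $\omega$ be a (finite a.e.) Lebesgue measurable function on $I$ with $\omega>0$ a.e. Let $L_0(I)$ be the space of all (a.e.-equivalence classes of) real-valued Lebesgue measurable functions on $I$, and let $$C_{p,\omega}=C_{p,\omega}(I)=\{f\in L_0(I):\|f\|_{C_{p,\omega}}<\infty\},\qquad \|f\|_{C_{p,\omega}}=\Bigl(\int_I\Bigl(\omega(x)\int_0^x|f(t)|\,dt\Bigr)^p dx\Bigr)^{1/p},$$ which is a real Banach space (the weighted Cesàro function space). A real Banach space $X$ with unit ball $B_X$ and unit sphere $S_X$ is called weakly almost square (WASQ) if for every $x\in S_X$ there is a sequence $(y_n)\subset B_X$ with $\|x\pm y_n\|\to1$, $\|y_n\|\to1$ and $y_n\to0$ weakly. It is called almost square (ASQ) if for every finite (possibly empty) subset $F\subset S_X$ there is a sequence $(y_n)\subset B_X$ with $\|x\pm y_n\|\to1$ for every $x\in F$, and $\|y_n\|\to1$. Proposition. The space $C_{p,\omega}$ contains no isomorphic copy of $c_0$; moreover $C_{p,\omega}$ is WASQ but not ASQ. For instance, $L_1[0,1]$,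 which is isometrically isomorphic to $C_{1,1/x}(0,1)$, is WASQ but not ASQ. -/

import Mathlib

open MeasureTheory Filter Topology Set
open scoped ENNReal ZeroAtInfty

noncomputable section

/-! ### Almost square Banach spaces and copies of `c₀` -/

/-- A real Banach space is weakly almost square (WASQ) if for every `x` in the unit sphere there
is a sequence `yₙ` in the unit ball with `‖x ± yₙ‖ → 1`, `‖yₙ‖ → 1` and `yₙ → 0` weakly. -/
def IsWASQ (X : Type*) [NormedAddCommGroup X] [NormedSpace ℝ X] [CompleteSpace X] : Prop :=
  ∀ x : X, ‖x‖ = 1 → ∃ y : ℕ → X, (∀ n, ‖y n‖ ≤ 1) ∧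
    Tendsto (fun n => ‖x + y n‖) atTop (𝓝 1) ∧
    Tendsto (fun n => ‖x - y n‖) atTop (𝓝 1) ∧
    Tendsto (fun n => ‖y n‖) atTop (𝓝 1) ∧
    ∀ φ : X →L[ℝ] ℝ, Tendsto (fun n => φ (y n)) atTop (𝓝 0)

/-- A real Banach space is almost square (ASQ) if for every finite subset `s` of the unit sphere
there is a sequence `yₙ` in the unit ball with `‖x ± yₙ‖ → 1` for every `x ∈ s` and
`‖yₙ‖ → 1`. -/
def IsASQ (X : Type*) [NormedAddCommGroup X] [NormedSpace ℝ X] [CompleteSpace X] : Prop :=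
  ∀ s : Set X, s.Finite → (∀ x ∈ s, ‖x‖ = 1) → ∃ y : ℕ → X, (∀ n, ‖y n‖ ≤ 1) ∧
    (∀ x ∈ s, Tendsto (fun n => ‖x + y n‖) atTop (𝓝 1) ∧
      Tendsto (fun n => ‖x - y n‖) atTop (𝓝 1)) ∧
    Tendsto (fun n => ‖y n‖) atTop (𝓝 1)

/-- `X` contains an isomorphic copy of `c₀`: some linear subspace of `X` is linearly homeomorphic
to `c₀`, the space of real null sequences with the supremum norm (`C₀(ℕ, ℝ)`, with `ℕ`
discrete). -/
def ContainsCopyOfC0 (X : Type*) [NormedAddCommGroup X] [NormedSpace ℝ X] : Prop :=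
  ∃ Y : Submodule ℝ X, Nonempty (C₀(ℕ, ℝ) ≃L[ℝ] Y)

/-! ### Weighted Cesàro function spaces -/

namespace Cesaro

/-- The interval `I = (0, l)`; here `l` may be `∞`. -/
def interval (l : EReal) : Set ℝ := {x | 0 < x ∧ (x : EReal) < l}

/-- Lebesgue measure on `I = (0, l)`. -/
def vol (l : EReal) : Measure ℝ := volume.restrict (interval l)

/-- `L₀(I)`: classes modulo a.e. equality of real valued Lebesgue measurable functions on `I`. -/
abbrev L0 (l : EReal) : Type := ℝ →ₘ[vol l] ℝ

/-- A weight on `I`: an element `ω` of `L₀(I)` with `ω > 0` a.e. on `I`. -/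
structure Weight (l : EReal) where
  toL0 : L0 l
  pos : ∀ᵐ x ∂(vol l), 0 < toL0 x

/-- `(∫_I (ω(x) ∫_0^x g(t) dt)^p dx)^{1/p}` for a function `g ≥ 0`, with values in `[0, ∞]`. -/
def lnorm (p : ℝ) {l : EReal} (ω : Weight l) (g : ℝ → ℝ≥0∞) : ℝ≥0∞ :=
  (∫⁻ x, (ENNReal.ofReal (ω.toL0 x) * ∫⁻ t in Ioo 0 x, g t) ^ p ∂(vol l)) ^ (1 / p)

/-- `‖f‖_{C_{p,ω}} = (∫_I (ω(x) ∫_0^x |f(t)| dt)^p dx)^{1/p}`, with values in `[0, ∞]`. -/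
def enorm (p : ℝ) {l : EReal} (ω : Weight l) (f : L0 l) : ℝ≥0∞ :=
  lnorm p ω fun t => ENNReal.ofReal |f t|

section helpers

variable {p : ℝ} {l : EReal} {ω : Weight l}

theorem isOpen_interval (l : EReal) : IsOpen (interval l) :=
  isOpen_Ioi.inter (isOpen_Iio.preimage continuous_coe_real_ereal)

theorem measurableSet_interval (l : EReal) : MeasurableSet (interval l) :=
  (isOpen_interval l).measurableSet

theorem Ioo_subset {x : ℝ} (hx : x ∈ interval l) : Ioo 0 x ⊆ interval l := fun _ ht =>
  ⟨ht.1, (EReal.coe_lt_coe_iff.2 ht.2).trans hx.2⟩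

theorem restrict_le {x : ℝ} (hx : x ∈ interval l) :
    (volume : Measure ℝ).restrict (Ioo 0 x) ≤ vol l :=
  Measure.restrict_mono (Ioo_subset hx) le_rfl

theorem ae_mem (l : EReal) : ∀ᵐ x ∂(vol l), x ∈ interval l :=
  ae_restrict_mem (measurableSet_interval l)

theorem ae_inner {q : ℝ → Prop} (h : ∀ᵐ t ∂(vol l), q t) {x : ℝ} (hx : x ∈ interval l) :
    ∀ᵐ t ∂(volume.restrict (Ioo 0 x)), q t :=
  (Measure.absolutelyContinuous_of_le (restrict_le hx)).ae_le h

theorem lnorm_mono (hp : 1 ≤ p) {g h : ℝ → ℝ≥0∞} (hgh : ∀ᵐ t ∂(vol l), g t ≤ h t) :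
    lnorm p ω g ≤ lnorm p ω h := by
  unfold lnorm
  refine ENNReal.rpow_le_rpow (lintegral_mono_ae ?_) (by positivity)
  filter_upwards [ae_mem l] with x hx
  refine ENNReal.rpow_le_rpow ?_ (by positivity)
  gcongr 1
  exact lintegral_mono_ae (ae_inner hgh hx)

theorem lnorm_congr (hp : 1 ≤ p) {g h : ℝ → ℝ≥0∞} (hgh : g =ᵐ[vol l] h) :
    lnorm p ω g = lnorm p ω h :=
  le_antisymm (lnorm_mono hp hgh.le) (lnorm_mono hp hgh.symm.le)

theorem measurable_prim (g : ℝ → ℝ≥0∞) : Measurable fun x : ℝ => ∫⁻ t in Ioo 0 x, g t :=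
  Monotone.measurable fun _ _ hxy => lintegral_mono_set (Ioo_subset_Ioo_right hxy)

theorem aemeasurable_inner (ω : Weight l) (g : ℝ → ℝ≥0∞) :
    AEMeasurable (fun x => ENNReal.ofReal (ω.toL0 x) * ∫⁻ t in Ioo 0 x, g t) (vol l) :=
  ω.toL0.aestronglyMeasurable.aemeasurable.ennreal_ofReal.mul (measurable_prim g).aemeasurable

theorem lnorm_zero (hp : 1 ≤ p) : lnorm p ω (fun _ => 0) = 0 := by
  have h0 : 0 < p := by linarith
  simp [lnorm, h0]

theorem lnorm_add_le (hp : 1 ≤ p) {g h : ℝ → ℝ≥0∞} (hg : AEMeasurable g (vol l)) :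
    lnorm p ω (fun t => g t + h t) ≤ lnorm p ω g + lnorm p ω h := by
  refine le_trans (le_of_eq ?_)
    (ENNReal.lintegral_Lp_add_le (aemeasurable_inner ω g) (aemeasurable_inner ω h) hp)
  unfold lnorm
  congr 1
  refine lintegral_congr_ae ?_
  filter_upwards [ae_mem l] with x hx
  simp only [Pi.add_apply]
  rw [lintegral_add_left' (hg.mono_measure (restrict_le hx)), mul_add]

theorem lnorm_sum_le (hp : 1 ≤ p) {g : ℕ → ℝ → ℝ≥0∞} (hg : ∀ n, AEMeasurable (g n) (vol l))
    (N : ℕ) : lnorm p ω (fun t => ∑ n ∈ Finset.range N, g n t) ≤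
      ∑ n ∈ Finset.range N, lnorm p ω (g n) := by
  induction N with
  | zero => simp [lnorm_zero hp]
  | succ N ih =>
    simp only [Finset.sum_range_succ]
    refine (lnorm_add_le hp (Finset.aemeasurable_fun_sum _ fun n _ => hg n)).trans ?_
    gcongr

theorem lnorm_iSup (hp : 1 ≤ p) {g : ℕ → ℝ → ℝ≥0∞} (hg : ∀ n, AEMeasurable (g n) (vol l))
    (hmono : ∀ t, Monotone fun n => g n t) :
    lnorm p ω (fun t => ⨆ n, g n t) = ⨆ n, lnorm p ω (g n) := by
  have h0 : 0 < p := by linarith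
  have key : (∫⁻ x, (ENNReal.ofReal (ω.toL0 x) * ∫⁻ t in Ioo 0 x, ⨆ n, g n t) ^ p ∂(vol l)) =
      ⨆ n, ∫⁻ x, (ENNReal.ofReal (ω.toL0 x) * ∫⁻ t in Ioo 0 x, g n t) ^ p ∂(vol l) := by
    rw [← lintegral_iSup' (fun n => (aemeasurable_inner ω (g n)).pow_const p)]
    · refine lintegral_congr_ae ?_
      filter_upwards [ae_mem l] with x hx
      rw [lintegral_iSup' (fun n => (hg n).mono_measure (restrict_le hx))
        (Eventually.of_forall hmono), ENNReal.mul_iSup]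
      exact (ENNReal.orderIsoRpow p h0).map_iSup _
    · refine Eventually.of_forall fun x n m hnm => ?_
      refine ENNReal.rpow_le_rpow ?_ h0.le
      gcongr 1
      exact lintegral_mono fun t => hmono t hnm
  unfold lnorm
  rw [key]
  exact (ENNReal.orderIsoRpow (1 / p) (by positivity)).map_iSup _

theorem lnorm_tsum_le (hp : 1 ≤ p) {g : ℕ → ℝ → ℝ≥0∞} (hg : ∀ n, AEMeasurable (g n) (vol l)) :
    lnorm p ω (fun t => ∑' n, g n t) ≤ ∑' n, lnorm p ω (g n) := by
  simp only [ENNReal.tsum_eq_iSup_nat]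
  rw [lnorm_iSup hp (fun N => Finset.aemeasurable_fun_sum _ fun n _ => hg n)
    (fun t => monotone_nat_of_le_succ fun n => by simp [Finset.sum_range_succ])]
  exact iSup_mono fun N => lnorm_sum_le hp hg N

theorem lnorm_const_mul (hp : 1 ≤ p) {c : ℝ≥0∞} (hc : c ≠ ∞) (g : ℝ → ℝ≥0∞) :
    lnorm p ω (fun t => c * g t) = c * lnorm p ω g := by
  have h0 : 0 < p := by linarith
  unfold lnorm
  simp only [lintegral_const_mul' c _ hc, mul_left_comm _ c, ENNReal.mul_rpow_of_nonneg _ _ h0.le]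
  rw [lintegral_const_mul' _ _ (ENNReal.rpow_ne_top_of_nonneg h0.le hc),
    ENNReal.mul_rpow_of_nonneg _ _ (by positivity), ← ENNReal.rpow_mul, mul_one_div_cancel h0.ne',
    ENNReal.rpow_one]

/-- A property of points that holds a.e. on `(0, x)` for a.e. `x ∈ I` holds a.e. on `I`. -/
theorem ae_of_ae_ae {q : ℝ → Prop}
    (h : ∀ᵐ x ∂(vol l), ∀ᵐ t ∂(volume.restrict (Ioo 0 x)), q t) : ∀ᵐ t ∂(vol l), q t := by
  have hU : interval l = ⋃ r : {r : ℚ // (r : ℝ) ∈ interval l}, Ioo (0 : ℝ) (r : ℚ) := by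
    ext x
    simp only [mem_iUnion]
    constructor
    · intro hx
      obtain ⟨z, hxz, hz⟩ := EReal.lt_iff_exists_rat_btwn.1 hx.2
      have hxz' : x < (z : ℝ) := EReal.coe_lt_coe_iff.1 hxz
      exact ⟨⟨z, hx.1.trans hxz', hz⟩, hx.1, hxz'⟩
    · rintro ⟨r, hr⟩
      exact Ioo_subset r.2 hr
  rw [vol, hU, ae_restrict_iUnion_iff]
  rintro ⟨r, hr⟩
  have hopen : IsOpen (Ioi (r : ℝ) ∩ interval l) := isOpen_Ioi.inter (isOpen_interval l)
  have hne : (Ioi (r : ℝ) ∩ interval l).Nonempty := by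
    obtain ⟨z, hrz, hz⟩ := EReal.lt_iff_exists_real_btwn.1 hr.2
    have hrz' : (r : ℝ) < z := EReal.coe_lt_coe_iff.1 hrz
    exact ⟨z, hrz', hr.1.trans hrz', hz⟩
  have hpos := hopen.measure_pos volume hne
  have h2 : ∃ x ∈ Ioi (r : ℝ) ∩ interval l, ∀ᵐ t ∂(volume.restrict (Ioo 0 x)), q t := by
    by_contra hcon
    refine hpos.ne' ?_
    rw [vol, ae_restrict_iff' (measurableSet_interval l)] at h
    refine measure_mono_null (fun x hx => ?_) h
    exact fun hh => hcon ⟨x, hx, hh hx.2⟩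
  obtain ⟨x, hx, hq⟩ := h2
  exact (Measure.absolutelyContinuous_of_le
    (Measure.restrict_mono (Ioo_subset_Ioo_right (le_of_lt hx.1)) le_rfl)).ae_le hq

theorem ae_eq_zero_of_lnorm (hp : 1 ≤ p) {g : ℝ → ℝ≥0∞} (hg : AEMeasurable g (vol l))
    (h : lnorm p ω g = 0) : ∀ᵐ t ∂(vol l), g t = 0 := by
  have h0 : 0 < p := by linarith
  rw [lnorm, ENNReal.rpow_eq_zero_iff_of_pos (by positivity),
    lintegral_eq_zero_iff' ((aemeasurable_inner ω g).pow_const p)] at h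
  refine ae_of_ae_ae ?_
  filter_upwards [h, ae_mem l, ω.pos] with x hx hxI hω
  simp only [Pi.zero_apply, ENNReal.rpow_eq_zero_iff_of_pos h0, mul_eq_zero,
    ENNReal.ofReal_eq_zero, not_le.2 hω, false_or] at hx
  exact (lintegral_eq_zero_iff' (hg.mono_measure (restrict_le hxI))).1 hx

theorem ae_lt_top_of_lnorm (hp : 1 ≤ p) {g : ℝ → ℝ≥0∞} (hg : AEMeasurable g (vol l))
    (h : lnorm p ω g < ∞) : ∀ᵐ t ∂(vol l), g t < ∞ := by
  have h0 : 0 < p := by linarith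
  rw [lnorm, ENNReal.rpow_lt_top_iff_of_pos (by positivity)] at h
  have h1 := ae_lt_top' ((aemeasurable_inner ω g).pow_const p) h.ne
  refine ae_of_ae_ae ?_
  filter_upwards [h1, ae_mem l, ω.pos] with x hx hxI hω
  rw [ENNReal.rpow_lt_top_iff_of_pos h0] at hx
  refine ae_lt_top' (hg.mono_measure (restrict_le hxI)) fun htop => ?_
  rw [htop, ENNReal.mul_top (by simpa using hω)] at hx
  exact lt_irrefl _ hx

theorem aemeasurable_abs (f : L0 l) : AEMeasurable (fun t => ENNReal.ofReal |f t|) (vol l) :=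
  (continuous_abs.measurable.comp_aemeasurable f.aestronglyMeasurable.aemeasurable).ennreal_ofReal

theorem enorm_zero (hp : 1 ≤ p) : enorm p ω (0 : L0 l) = 0 := by
  rw [← lnorm_zero (ω := ω) hp]
  refine lnorm_congr hp ?_
  filter_upwards [AEEqFun.coeFn_zero (α := ℝ) (β := ℝ) (μ := vol l)] with t ht
  simp [ht]

theorem enorm_add_le (hp : 1 ≤ p) (f g : L0 l) :
    enorm p ω (f + g) ≤ enorm p ω f + enorm p ω g := by
  refine le_trans (lnorm_mono hp ?_) (lnorm_add_le hp (aemeasurable_abs f))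
  filter_upwards [AEEqFun.coeFn_add f g] with t ht
  rw [ht, Pi.add_apply, ← ENNReal.ofReal_add (abs_nonneg _) (abs_nonneg _)]
  exact ENNReal.ofReal_le_ofReal (abs_add_le _ _)

theorem enorm_smul (hp : 1 ≤ p) (c : ℝ) (f : L0 l) :
    enorm p ω (c • f) = ENNReal.ofReal |c| * enorm p ω f := by
  rw [enorm, enorm, ← lnorm_const_mul hp ENNReal.ofReal_ne_top]
  refine lnorm_congr hp ?_
  filter_upwards [AEEqFun.coeFn_smul c f] with t ht
  rw [ht, Pi.smul_apply, smul_eq_mul, abs_mul, ENNReal.ofReal_mul (abs_nonneg _)]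

theorem eq_zero_of_enorm (hp : 1 ≤ p) {f : L0 l} (h : enorm p ω f = 0) : f = 0 := by
  refine AEEqFun.ext ?_
  filter_upwards [ae_eq_zero_of_lnorm hp (aemeasurable_abs f) h,
    AEEqFun.coeFn_zero (α := ℝ) (β := ℝ) (μ := vol l)] with t ht h0
  rw [h0]
  simpa using ht

end helpers

/-- The weighted Cesàro function space
`C_{p,ω}(I) = {f ∈ L₀(I) : ‖f‖_{C_{p,ω}} < ∞}`, as a linear subspace of `L₀(I)`. -/
def space (p : ℝ) [hp : Fact (1 ≤ p)] {l : EReal} (ω : Weight l) : Submodule ℝ (L0 l) where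
  carrier := {f | enorm p ω f < ∞}
  zero_mem' := by simp [enorm_zero hp.out]
  add_mem' := fun {f g} hf hg =>
    (enorm_add_le hp.out f g).trans_lt (ENNReal.add_lt_top.2 ⟨hf, hg⟩)
  smul_mem' := fun c f hf => by
    change enorm p ω f < ∞ at hf
    change enorm p ω (c • f) < ∞
    rw [enorm_smul hp.out]
    exact ENNReal.mul_lt_top ENNReal.ofReal_lt_top hf

section instances

variable {p : ℝ} [hp : Fact (1 ≤ p)] {l : EReal} {ω : Weight l}

instance instNormSpace : Norm (space p ω) := ⟨fun f => (enorm p ω (f : L0 l)).toReal⟩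

theorem norm_def (f : space p ω) : ‖f‖ = (enorm p ω (f : L0 l)).toReal := rfl

theorem ofReal_norm (f : space p ω) : ENNReal.ofReal ‖f‖ = enorm p ω (f : L0 l) :=
  ENNReal.ofReal_toReal (LT.lt.ne f.2)

theorem normCore (p : ℝ) [hp : Fact (1 ≤ p)] {l : EReal} (ω : Weight l) :
    NormedSpace.Core ℝ (space p ω) where
  norm_nonneg _ := ENNReal.toReal_nonneg
  norm_smul c f := by
    rw [norm_def, norm_def, Submodule.coe_smul, enorm_smul hp.out, ENNReal.toReal_mul,
      ENNReal.toReal_ofReal (abs_nonneg c), Real.norm_eq_abs]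
  norm_triangle f g := by
    rw [norm_def, norm_def, norm_def, ← ENNReal.toReal_add (LT.lt.ne f.2) (LT.lt.ne g.2)]
    exact ENNReal.toReal_mono (ENNReal.add_ne_top.2 ⟨LT.lt.ne f.2, LT.lt.ne g.2⟩)
      (enorm_add_le hp.out _ _)
  norm_eq_zero_iff f := by
    rw [norm_def, ENNReal.toReal_eq_zero_iff]
    constructor
    · rintro (h | h)
      · exact Subtype.ext (eq_zero_of_enorm hp.out h)
      · exact absurd h (LT.lt.ne f.2)
    · rintro rfl
      exact Or.inl (enorm_zero hp.out)

/-- `C_{p,ω}(I)` with the norm `‖·‖_{C_{p,ω}}`. -/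
instance instNormedAddCommGroupSpace : NormedAddCommGroup (space p ω) :=
  NormedAddCommGroup.ofCore (normCore p ω)

instance instNormedSpaceSpace : NormedSpace ℝ (space p ω) := NormedSpace.ofCore (normCore p ω)

theorem coeFn_sum_range (u : ℕ → space p ω) (N : ℕ) :
    ((∑ n ∈ Finset.range N, u n : space p ω) : L0 l) =ᵐ[vol l]
      fun t => ∑ n ∈ Finset.range N, (u n : L0 l) t := by
  induction N with
  | zero =>
    simp only [Finset.range_zero, Finset.sum_empty, Submodule.coe_zero]
    exact AEEqFun.coeFn_zero
  | succ N ih =>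
    rw [Finset.sum_range_succ, Submodule.coe_add]
    filter_upwards [AEEqFun.coeFn_add ((∑ n ∈ Finset.range N, u n : space p ω) : L0 l)
      (u N : L0 l), ih] with t h1 h2
    rw [h1, Pi.add_apply, h2, Finset.sum_range_succ]

instance instCompleteSpaceSpace : CompleteSpace (space p ω) := by
  refine NormedAddCommGroup.completeSpace_of_summable_imp_tendsto fun u hu => ?_
  set g : ℕ → ℝ → ℝ≥0∞ := fun n t => ENNReal.ofReal |(u n : L0 l) t| with hg
  have hgm : ∀ n, AEMeasurable (g n) (vol l) := fun n => aemeasurable_abs _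
  have hsum : ∑' n, lnorm p ω (g n) < ∞ := by
    have : ∀ n, lnorm p ω (g n) = ENNReal.ofReal ‖u n‖ := fun n => (ofReal_norm _).symm
    simp only [this]
    exact hu.tsum_ofReal_lt_top
  have hfin : ∀ᵐ t ∂(vol l), ∑' n, g n t < ∞ :=
    ae_lt_top_of_lnorm (ω := ω) hp.out (AEMeasurable.tsum hgm)
      ((lnorm_tsum_le hp.out hgm).trans_lt hsum)
  have hsummable : ∀ᵐ t ∂(vol l), Summable fun n => (u n : L0 l) t := by
    filter_upwards [hfin] with t ht
    refine Summable.of_abs ?_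
    refine (ENNReal.summable_toReal ht.ne).congr fun n => ?_
    simp [hg]
  have hmeas : AEStronglyMeasurable (fun t => ∑' n, (u n : L0 l) t) (vol l) := by
    refine aestronglyMeasurable_of_tendsto_ae atTop
      (f := fun N t => ∑ n ∈ Finset.range N, (u n : L0 l) t) (fun N => ?_) ?_
    · exact Finset.aestronglyMeasurable_fun_sum _ fun n _ => (u n : L0 l).aestronglyMeasurable
    · filter_upwards [hsummable] with t ht
      exact ht.hasSum.tendsto_sum_nat
  set F : L0 l := AEEqFun.mk _ hmeas with hF
  have htail : ∀ N, enorm p ω (F - (∑ n ∈ Finset.range N, u n : space p ω)) ≤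
      ∑' n, lnorm p ω (g (n + N)) := by
    intro N
    refine le_trans (lnorm_mono hp.out ?_) (lnorm_tsum_le hp.out fun n => hgm (n + N))
    filter_upwards [hsummable, AEEqFun.coeFn_mk _ hmeas, coeFn_sum_range u N,
      AEEqFun.coeFn_sub F ((∑ n ∈ Finset.range N, u n : space p ω) : L0 l)] with t h1 h2 h3 h4
    rw [h4, Pi.sub_apply, h2, h3, ← h1.sum_add_tsum_nat_add N, add_sub_cancel_left]
    have h5 : Summable fun n => |(u (n + N) : L0 l) t| :=
      ((summable_nat_add_iff N).2 h1).abs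
    rw [← ENNReal.ofReal_tsum_of_nonneg (fun n => abs_nonneg _) h5]
    refine ENNReal.ofReal_le_ofReal ?_
    simpa using norm_tsum_le_tsum_norm (f := fun n => (u (n + N) : L0 l) t) (by simpa using h5)
  have hFmem : F ∈ space p ω := by
    have h := htail 0
    simp only [Finset.range_zero, Finset.sum_empty, Submodule.coe_zero, sub_zero, add_zero] at h
    exact h.trans_lt hsum
  refine ⟨⟨F, hFmem⟩, ?_⟩
  rw [tendsto_iff_norm_sub_tendsto_zero]
  have hlim := ENNReal.tendsto_sum_nat_add (fun n => lnorm p ω (g n)) hsum.ne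
  have hlim' := (ENNReal.tendsto_toReal ENNReal.zero_ne_top).comp
    (tendsto_of_tendsto_of_tendsto_of_le_of_le tendsto_const_nhds hlim (fun _ => bot_le) htail)
  simpa [norm_sub_rev _ (⟨F, hFmem⟩ : space p ω), norm_def, Function.comp_def] using hlim'

end instances

/-- The weight `ω(x) = 1/x` on `(0, 1)`. -/
def invWeight : Weight 1 where
  toL0 := AEEqFun.mk (fun x : ℝ => 1 / x) (by
    simp only [one_div]; exact measurable_inv.aestronglyMeasurable)
  pos := by
    filter_upwards [AEEqFun.coeFn_mk (μ := vol 1) (fun x : ℝ => 1 / x) (by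
      simp only [one_div]; exact measurable_inv.aestronglyMeasurable), ae_mem 1] with x hx hxI
    rw [hx]
    exact one_div_pos.2 hxI.1

instance instFactOneLeOne : Fact ((1 : ℝ) ≤ 1) := ⟨le_rfl⟩

end Cesaro

end

/-! Everything rests on the lattice structure of `C_{p,ω}`: the norm depends only on `|f|`, is
`p`-superadditive on nonnegative functions, and obeys monotone and dominated convergence.

WASQ: take `yₙ = rₙ f` with `rₙ` the Rademacher functions, so `|yₙ| = |f|`. Since `|f ± rₙ f| = |f|
(1 ± rₙ)`, a Riemann–Lebesgue argument on each `(0, x)` followed by dominated convergence in `x`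
gives `‖f ± yₙ‖ → ‖f‖`. Weak nullity needs no description of the dual: along every subsequence the
arithmetic means of `rₙ`, taken at square lengths, tend to `0` a.e., so those of `rₙ f` tend to `0`
in norm (`tendsto_zero_of_cesaroMean`).

Not ASQ: if `‖x ± yₙ‖ → ‖x‖`, superadditivity forces the part of `yₙ` off the support of `x` to
vanish in norm (`tendsto_lnorm_off_support`). Two disjointly supported unit vectors then force `‖yₙ‖
→ 0`. Such a pair comes from normalising `f + rₙ f` and `f - rₙ f`.

No copy of `c₀`: the unit vectors of `c₀` have bounded signed sums but do not tend to `0`. In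
`C_{p,ω}` bounded signed sums bound the square function `(∑ xₖ²)^{1/2}` in norm, by a pointwise
Khinchine inequality. It dominates every `|xₖ|` and is finite a.e., so `xₖ → 0` a.e. and hence in
norm (`tendsto_zero_of_bounded_sign_sums`).

For `L₁`, Tonelli turns the norm of `C_{1,1/x}` into the `L₁` norm with density `-log t`. -/

noncomputable section

/-! ### Rademacher functions -/

/-- The `n`-th Rademacher function on `ℝ`: it is `1`-periodic with values `±1`. -/
def rademacher (n : ℕ) (t : ℝ) : ℝ := (Int.negOnePow ⌊2 ^ (n + 1) * t⌋ : ℤ)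

theorem rademacher_eq_or (n : ℕ) (t : ℝ) : rademacher n t = 1 ∨ rademacher n t = -1 := by
  unfold rademacher
  rcases Int.units_eq_one_or (Int.negOnePow ⌊2 ^ (n + 1) * t⌋) with h | h <;> simp [h]

theorem abs_rademacher (n : ℕ) (t : ℝ) : |rademacher n t| = 1 := by
  rcases rademacher_eq_or n t with h | h <;> simp [h]

theorem rademacher_mul_self (n : ℕ) (t : ℝ) : rademacher n t * rademacher n t = 1 := by
  rcases rademacher_eq_or n t with h | h <;> simp [h]

theorem measurable_rademacher (n : ℕ) : Measurable (rademacher n) := by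
  have h : Measurable fun k : ℤ => ((Int.negOnePow k : ℤ) : ℝ) := measurable_from_top
  exact h.comp (Int.measurable_floor.comp (measurable_const.mul measurable_id))

theorem rademacher_antiperiodic (n : ℕ) :
    Function.Antiperiodic (rademacher n) (1 / 2 ^ (n + 1)) := by
  intro t
  unfold rademacher
  have : (2 : ℝ) ^ (n + 1) * (t + 1 / 2 ^ (n + 1)) = 2 ^ (n + 1) * t + 1 := by field_simp
  rw [this, Int.floor_add_one, Int.negOnePow_succ]
  simp

theorem rademacher_periodic {n k : ℕ} (hk : k ≤ n) :
    Function.Periodic (rademacher n) (1 / 2 ^ k) := by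
  have h := (rademacher_antiperiodic n).periodic_two_mul.nat_mul (2 ^ (n - k))
  suffices hk' : ((2 ^ (n - k) : ℕ) : ℝ) * (2 * (1 / 2 ^ (n + 1))) = 1 / 2 ^ k by rwa [hk'] at h
  have : (2 : ℝ) ^ (n + 1) = 2 * 2 ^ (n - k) * 2 ^ k := by
    rw [mul_assoc, ← pow_add, Nat.sub_add_cancel hk, pow_succ]; ring
  rw [this]
  push_cast
  field_simp

/-- Translation by `1 / 2 ^ (i + 1)` flips the sign of the `i`-th factor and is a period of the
`j`-th, while the integral over a unit interval is translation invariant. So the integral equals its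
own negative. -/
theorem integral_rademacher_mul {i j : ℕ} (hij : i < j) (a : ℝ) :
    ∫ t in a..(a + 1), rademacher i t * rademacher j t = 0 := by
  set F : ℝ → ℝ := fun t => rademacher i t * rademacher j t with hF
  set c : ℝ := 1 / 2 ^ (i + 1) with hc
  have hper : Function.Periodic F 1 := by
    have h : ∀ n, Function.Periodic (rademacher n) 1 := fun n => by
      simpa using rademacher_periodic (Nat.zero_le n)
    exact (h i).mul (h j)
  have hanti : ∀ t, F (t + c) = -F t := fun t => by
    simp only [hF]
    rw [rademacher_antiperiodic i t, rademacher_periodic (Nat.succ_le_of_lt hij) t, neg_mul]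
  have h1 : ∫ t in a..(a + 1), F (t + c) = ∫ t in a..(a + 1), F t := by
    rw [intervalIntegral.integral_comp_add_right, add_right_comm]
    exact hper.intervalIntegral_add_eq _ _
  simp only [hanti, intervalIntegral.integral_neg] at h1
  change ∫ t in a..(a + 1), F t = 0
  linarith

theorem integral_sq_sum_rademacher {n : ℕ → ℕ} (hn : StrictMono n) (a : ℝ) (N : ℕ) :
    ∫ t in a..(a + 1), (∑ k ∈ Finset.range N, rademacher (n k) t) ^ 2 = N := by
  have hint : ∀ i j, IntervalIntegrable (fun t => rademacher i t * rademacher j t) volume a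
      (a + 1) := by
    intro i j
    rw [intervalIntegrable_iff]
    refine Measure.integrableOn_of_bounded (M := 1) (by simp)
      ((measurable_rademacher i).mul (measurable_rademacher j)).aestronglyMeasurable ?_
    exact Eventually.of_forall fun t => by simp [abs_rademacher]
  simp only [sq, Finset.sum_mul_sum]
  have hint' : ∀ i, IntervalIntegrable
      (fun t => ∑ j ∈ Finset.range N, rademacher (n i) t * rademacher (n j) t) volume a
      (a + 1) := fun i => by
    simpa only [Finset.sum_fn] using IntervalIntegrable.sum (Finset.range N)
      (f := fun j t => rademacher (n i) t * rademacher (n j) t) fun j _ => hint _ _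
  rw [intervalIntegral.integral_finsetSum fun i _ => hint' i]
  have h1 : ∀ i ∈ Finset.range N, ∫ t in a..(a + 1),
      ∑ j ∈ Finset.range N, rademacher (n i) t * rademacher (n j) t = 1 := by
    intro i hi
    rw [intervalIntegral.integral_finsetSum fun j _ => hint _ _, Finset.sum_eq_single_of_mem i hi]
    · simp [rademacher_mul_self]
    · intro j _ hji
      rcases lt_or_gt_of_ne hji with h | h
      · simp only [mul_comm (rademacher (n i) _)]
        exact integral_rademacher_mul (hn h) a
      · exact integral_rademacher_mul (hn h) a
  rw [Finset.sum_congr rfl h1]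
  simp

/-- The arithmetic mean of the first `N` terms of a sequence. -/
def cesaroMean {E : Type*} [AddCommGroup E] [Module ℝ E] (u : ℕ → E) (N : ℕ) : E :=
  (N : ℝ)⁻¹ • ∑ k ∈ Finset.range N, u k

theorem abs_cesaroMean_rademacher_le (n : ℕ → ℕ) (N : ℕ) (t : ℝ) :
    |cesaroMean (fun k => rademacher (n k) t) N| ≤ 1 := by
  have h : |∑ k ∈ Finset.range N, rademacher (n k) t| ≤ N := by
    refine (Finset.abs_sum_le_sum_abs _ _).trans ?_
    simp [abs_rademacher]
  unfold cesaroMean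
  rw [smul_eq_mul, abs_mul, abs_of_nonneg (by positivity : (0 : ℝ) ≤ (N : ℝ)⁻¹)]
  exact inv_mul_le_one_of_le₀ h (by positivity)

theorem measurable_cesaroMean_rademacher (n : ℕ → ℕ) (N : ℕ) :
    Measurable fun t => cesaroMean (fun k => rademacher (n k) t) N := by
  simp only [cesaroMean, smul_eq_mul]
  exact (Finset.measurable_fun_sum _ fun k _ => measurable_rademacher (n k)).const_mul _

/-- By orthogonality the mean of `N` terms has second moment `1 / N` on each unit interval. This is
summable along squares, so the sum of the squared means is finite a.e. The shift `M + 1` avoids the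
empty mean. -/
theorem tendsto_cesaroMean_rademacher {n : ℕ → ℕ} (hn : StrictMono n) :
    ∀ᵐ t : ℝ, Tendsto (fun M : ℕ => cesaroMean (fun k => rademacher (n k) t) ((M + 1) ^ 2))
      atTop (𝓝 0) := by
  set h : ℕ → ℝ → ℝ := fun M t => cesaroMean (fun k => rademacher (n k) t) ((M + 1) ^ 2) with hh
  have hm : ∀ M, Measurable (h M) := fun M => measurable_cesaroMean_rademacher n _
  have hint : ∀ (M : ℕ) (a : ℝ), ∫⁻ t in Ioc a (a + 1), ENNReal.ofReal (h M t ^ 2) =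
      ENNReal.ofReal (1 / (M + 1 : ℝ) ^ 2) := by
    intro M a
    rw [← ofReal_integral_eq_lintegral_ofReal]
    · rw [← intervalIntegral.integral_of_le (by linarith)]
      simp only [hh, cesaroMean, smul_eq_mul, mul_pow]
      rw [intervalIntegral.integral_const_mul, integral_sq_sum_rademacher hn]
      congr 1
      push_cast
      field_simp
    · refine Measure.integrableOn_of_bounded (M := 1) (by simp)
        ((hm M).pow_const 2).aestronglyMeasurable (Eventually.of_forall fun t => ?_)
      simpa using abs_cesaroMean_rademacher_le n ((M + 1) ^ 2) t
    · exact Eventually.of_forall fun t => sq_nonneg _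
  have hsum : ∑' M : ℕ, ENNReal.ofReal (1 / (M + 1 : ℝ) ^ 2) < ∞ := by
    have : Summable fun M : ℕ => 1 / (M + 1 : ℝ) ^ 2 := by
      have := (summable_nat_add_iff 1).2 (Real.summable_one_div_nat_pow.2 one_lt_two)
      simpa using this
    exact this.tsum_ofReal_lt_top
  have key : ∀ m : ℤ, ∀ᵐ t ∂(volume.restrict (Ioc (m : ℝ) (m + 1))),
      Tendsto (fun M => h M t) atTop (𝓝 0) := by
    intro m
    have h1 : ∫⁻ t in Ioc (m : ℝ) (m + 1), ∑' M, ENNReal.ofReal (h M t ^ 2) ≠ ∞ := by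
      rw [lintegral_tsum fun M => ((hm M).pow_const 2).ennreal_ofReal.aemeasurable]
      simp only [hint]
      exact hsum.ne
    filter_upwards [ae_lt_top (Measurable.tsum fun M =>
      ((hm M).pow_const 2).ennreal_ofReal) h1] with t ht
    have h2 := (ENNReal.tendsto_toReal ENNReal.zero_ne_top).comp
      (ENNReal.tendsto_atTop_zero_of_tsum_ne_top ht.ne)
    have h3 : Tendsto (fun M => h M t ^ 2) atTop (𝓝 0) := by
      refine h2.congr fun M => ?_
      simp [ENNReal.toReal_ofReal (sq_nonneg _)]
    have h4 := h3.sqrt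
    simp only [Real.sqrt_sq_eq_abs, Real.sqrt_zero] at h4
    exact (tendsto_zero_iff_abs_tendsto_zero _).2 h4
  have := (ae_restrict_iUnion_iff (μ := (volume : Measure ℝ)) (fun m : ℤ => Ioc (m : ℝ) (m + 1))
    (fun t => Tendsto (fun M => h M t) atTop (𝓝 0))).2 key
  rwa [iUnion_Ioc_intCast, Measure.restrict_univ] at this

/-- A sequence each of whose subsequences has arbitrarily small arithmetic means is weakly null. -/
theorem tendsto_zero_of_cesaroMean {E : Type*} [NormedAddCommGroup E] [NormedSpace ℝ E]
    {y : ℕ → E} (h : ∀ n : ℕ → ℕ, StrictMono n → ∃ N : ℕ → ℕ, (∀ M, 0 < N M) ∧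
      Tendsto (fun M => cesaroMean (fun k => y (n k)) (N M)) atTop (𝓝 0)) (φ : E →L[ℝ] ℝ) :
    Tendsto (fun n => φ (y n)) atTop (𝓝 0) := by
  -- A one-sided bound suffices, as it is applied to `φ` and `-φ`: values at least `ε` along a
  -- subsequence would keep its arithmetic means at least `ε`.
  have key : ∀ (ψ : E →L[ℝ] ℝ) (ε : ℝ), 0 < ε → ∀ᶠ k in atTop, ψ (y k) < ε := by
    intro ψ ε hε
    by_contra hcon
    obtain ⟨n, hn, hle⟩ := extraction_of_frequently_atTop (not_eventually.1 hcon)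
    obtain ⟨N, hN, hlim⟩ := h n hn
    have h1 := (ψ.continuous.tendsto 0).comp hlim
    rw [map_zero] at h1
    refine (ge_of_tendsto h1 (b := ε) (Eventually.of_forall fun M => ?_)).not_gt hε
    have h2 : (N M : ℝ) * ε ≤ ∑ k ∈ Finset.range (N M), ψ (y (n k)) := by
      simpa using Finset.card_nsmul_le_sum (Finset.range (N M)) (fun k => ψ (y (n k))) ε
        fun k _ => not_lt.1 (hle k)
    have h3 : (0 : ℝ) < N M := Nat.cast_pos.2 (hN M)
    simp only [Function.comp, cesaroMean, map_smul, map_sum, smul_eq_mul]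
    rwa [← div_eq_inv_mul, le_div_iff₀' h3]
  refine Metric.tendsto_nhds.2 fun ε hε => ?_
  filter_upwards [key φ ε hε, key (-φ) ε hε] with k h1 h2
  rw [Real.dist_eq, sub_zero, abs_lt]
  simp only [neg_apply] at h2
  exact ⟨by linarith, h1⟩

/-- The weak-nullity criterion is used in `ℝ` with the identity functional; the means pass inside
the integral, where dominated convergence applies. -/
theorem tendsto_integral_mul_rademacher {s : Set ℝ} {g : ℝ → ℝ} (hg : IntegrableOn g s) :
    Tendsto (fun n => ∫ t in s, g t * rademacher n t) atTop (𝓝 0) := by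
  refine tendsto_zero_of_cesaroMean (y := fun n => ∫ t in s, g t * rademacher n t)
    (fun n hn => ⟨fun M => (M + 1) ^ 2, fun M => by positivity, ?_⟩) (ContinuousLinearMap.id ℝ ℝ)
  have hmean : ∀ N, cesaroMean (fun k => ∫ t in s, g t * rademacher (n k) t) N =
      ∫ t in s, g t * cesaroMean (fun k => rademacher (n k) t) N := by
    intro N
    have hi : ∀ k, IntegrableOn (fun t => g t * rademacher (n k) t) s := fun k =>
      hg.mul_bdd (c := 1) (measurable_rademacher _).aestronglyMeasurable
        (Eventually.of_forall fun t => by simp [abs_rademacher])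
    unfold cesaroMean
    rw [← integral_finsetSum _ fun k _ => hi k, smul_eq_mul, ← integral_const_mul]
    congr 1
    ext t
    rw [smul_eq_mul, ← Finset.mul_sum]
    ring
  simp only [hmean]
  rw [← integral_zero ℝ ℝ (μ := volume.restrict s)]
  refine tendsto_integral_of_dominated_convergence (fun t => |g t|)
    (fun M => hg.aestronglyMeasurable.mul
      (measurable_cesaroMean_rademacher n _).aestronglyMeasurable) hg.abs
    (fun M => Eventually.of_forall fun t => ?_) ?_
  · rw [norm_mul, Real.norm_eq_abs, Real.norm_eq_abs]
    exact mul_le_of_le_one_right (abs_nonneg _) (abs_cesaroMean_rademacher_le n _ t)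
  · filter_upwards [ae_restrict_of_ae (tendsto_cesaroMean_rademacher hn)] with t ht
    simpa using ht.const_mul (g t)

/-! ### Dominated convergence and superadditivity of the norm -/

namespace Cesaro

variable {p : ℝ} {l : EReal} {ω : Weight l}

theorem ae_inner_lt_top (hp : 1 ≤ p) {g : ℝ → ℝ≥0∞} (h : lnorm p ω g < ∞) :
    ∀ᵐ x ∂(vol l), ∫⁻ t in Ioo 0 x, g t < ∞ := by
  have h0 : 0 < p := by linarith
  rw [lnorm, ENNReal.rpow_lt_top_iff_of_pos (by positivity)] at h
  filter_upwards [ae_lt_top' ((aemeasurable_inner ω g).pow_const p) h.ne, ω.pos] with x hx hω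
  rw [ENNReal.rpow_lt_top_iff_of_pos h0] at hx
  refine lt_top_iff_ne_top.2 fun htop => ?_
  rw [htop, ENNReal.mul_top (by simpa using hω)] at hx
  exact lt_irrefl _ hx

/-- Only the inner integrals are required to converge, since oscillating functions such as `|f| (1 +
rₙ)` need not converge pointwise. -/
theorem tendsto_lnorm_of_dominated (hp : 1 ≤ p) {g : ℕ → ℝ → ℝ≥0∞} {g₀ G : ℝ → ℝ≥0∞}
    (hG : lnorm p ω G < ∞) (hle : ∀ n, ∀ᵐ t ∂(vol l), g n t ≤ G t)
    (hlim : ∀ᵐ x ∂(vol l), Tendsto (fun n => ∫⁻ t in Ioo 0 x, g n t) atTop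
      (𝓝 (∫⁻ t in Ioo 0 x, g₀ t))) :
    Tendsto (fun n => lnorm p ω (g n)) atTop (𝓝 (lnorm p ω g₀)) := by
  have h0 : 0 < p := by linarith
  unfold lnorm
  refine ((ENNReal.continuous_rpow_const (y := 1 / p)).tendsto _).comp ?_
  refine tendsto_lintegral_of_dominated_convergence'
    (fun x => (ENNReal.ofReal (ω.toL0 x) * ∫⁻ t in Ioo 0 x, G t) ^ p)
    (fun n => (aemeasurable_inner ω (g n)).pow_const p) (fun n => ?_) ?_ ?_
  · filter_upwards [ae_mem l] with x hx
    refine ENNReal.rpow_le_rpow ?_ h0.le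
    gcongr 1
    exact lintegral_mono_ae (ae_inner (hle n) hx)
  · rw [lnorm, ENNReal.rpow_lt_top_iff_of_pos (by positivity)] at hG
    exact hG.ne
  · filter_upwards [hlim] with x hx
    exact ((ENNReal.continuous_rpow_const (y := p)).tendsto _).comp
      (ENNReal.Tendsto.const_mul hx (Or.inr ENNReal.ofReal_ne_top))

theorem tendsto_lnorm_zero_of_dominated (hp : 1 ≤ p) {g : ℕ → ℝ → ℝ≥0∞} {G : ℝ → ℝ≥0∞}
    (hg : ∀ n, AEMeasurable (g n) (vol l))
    (hG : lnorm p ω G < ∞) (hle : ∀ n, ∀ᵐ t ∂(vol l), g n t ≤ G t)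
    (hlim : ∀ᵐ t ∂(vol l), Tendsto (fun n => g n t) atTop (𝓝 0)) :
    Tendsto (fun n => lnorm p ω (g n)) atTop (𝓝 0) := by
  rw [← lnorm_zero (p := p) (ω := ω) hp]
  refine tendsto_lnorm_of_dominated hp hG hle ?_
  filter_upwards [ae_inner_lt_top hp hG, ae_mem l] with x hx hxI
  exact tendsto_lintegral_of_dominated_convergence' G
    (fun n => (hg n).mono_measure (restrict_le hxI)) (fun n => ae_inner (hle n) hxI) hx.ne
    (ae_inner hlim hxI)

theorem lnorm_rpow (hp : 1 ≤ p) (g : ℝ → ℝ≥0∞) :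
    lnorm p ω g ^ p =
      ∫⁻ x, (ENNReal.ofReal (ω.toL0 x) * ∫⁻ t in Ioo 0 x, g t) ^ p ∂(vol l) := by
  have h0 : 0 < p := by linarith
  rw [lnorm, ← ENNReal.rpow_mul, one_div_mul_cancel h0.ne', ENNReal.rpow_one]

/-- The inner integral is additive, and `a ^ p + b ^ p ≤ (a + b) ^ p` for `p ≥ 1`. -/
theorem lnorm_rpow_add_le (hp : 1 ≤ p) {g h : ℝ → ℝ≥0∞} (hg : AEMeasurable g (vol l)) :
    lnorm p ω g ^ p + lnorm p ω h ^ p ≤ lnorm p ω (fun t => g t + h t) ^ p := by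
  simp only [lnorm_rpow hp]
  rw [← lintegral_add_left' ((aemeasurable_inner ω g).pow_const p)]
  refine lintegral_mono_ae ?_
  filter_upwards [ae_mem l] with x hx
  rw [lintegral_add_left' (hg.mono_measure (restrict_le hx)), mul_add]
  exact ENNReal.add_rpow_le_rpow_add _ _ hp

/-! ### Rademacher multiples and weak almost squareness -/

section space

variable [hp : Fact (1 ≤ p)]

theorem tendsto_enorm_of_tendsto_norm {u : ℕ → space p ω} {a : ℝ}
    (h : Tendsto (fun n => ‖u n‖) atTop (𝓝 a)) :
    Tendsto (fun n => enorm p ω (u n : L0 l)) atTop (𝓝 (ENNReal.ofReal a)) := by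
  simp only [← ofReal_norm]
  exact ENNReal.tendsto_ofReal h

theorem tendsto_norm_of_tendsto_enorm {u : ℕ → space p ω} {v : ℝ≥0∞} (hv : v ≠ ∞)
    (h : Tendsto (fun n => enorm p ω (u n : L0 l)) atTop (𝓝 v)) :
    Tendsto (fun n => ‖u n‖) atTop (𝓝 v.toReal) :=
  (ENNReal.tendsto_toReal hv).comp h

/-- The product of a function in `C_{p,ω}` with the `n`-th Rademacher function. -/
def rademacherMul (n : ℕ) (f : space p ω) : space p ω :=
  ⟨AEEqFun.mk _ (measurable_rademacher n).aestronglyMeasurable * (f : L0 l), by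
    refine lt_of_le_of_lt (lnorm_mono hp.out ?_) f.2
    filter_upwards [AEEqFun.coeFn_mul (AEEqFun.mk _
      (measurable_rademacher n).aestronglyMeasurable) (f : L0 l), AEEqFun.coeFn_mk _
      ((measurable_rademacher n).aestronglyMeasurable (μ := vol l))] with t h1 h2
    rw [h1, Pi.mul_apply, h2, abs_mul, abs_rademacher, one_mul]⟩

theorem coeFn_rademacherMul (n : ℕ) (f : space p ω) :
    (rademacherMul n f : L0 l) =ᵐ[vol l] fun t => rademacher n t * (f : L0 l) t := by
  filter_upwards [AEEqFun.coeFn_mul (AEEqFun.mk _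
    (measurable_rademacher n).aestronglyMeasurable) (f : L0 l), AEEqFun.coeFn_mk _
    ((measurable_rademacher n).aestronglyMeasurable (μ := vol l))] with t h1 h2
  change (AEEqFun.mk _ (measurable_rademacher n).aestronglyMeasurable * (f : L0 l) : L0 l) t = _
  rw [h1, Pi.mul_apply, h2]

theorem norm_rademacherMul (n : ℕ) (f : space p ω) : ‖rademacherMul n f‖ = ‖f‖ := by
  rw [norm_def, norm_def]
  congr 1
  refine lnorm_congr hp.out ?_
  filter_upwards [coeFn_rademacherMul n f] with t ht
  rw [ht, abs_mul, abs_rademacher, one_mul]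

theorem coeFn_cesaroMean_rademacherMul (n : ℕ → ℕ) (N : ℕ) (f : space p ω) :
    ((cesaroMean (fun k => rademacherMul (n k) f) N : space p ω) : L0 l) =ᵐ[vol l]
      fun t => cesaroMean (fun k => rademacher (n k) t) N * (f : L0 l) t := by
  filter_upwards [coeFn_sum_range (fun k => rademacherMul (n k) f) N,
    AEEqFun.coeFn_smul (N : ℝ)⁻¹
      ((∑ k ∈ Finset.range N, rademacherMul (n k) f : space p ω) : L0 l),
    ae_all_iff.2 fun k => coeFn_rademacherMul (n k) f] with t h1 h2 h3
  unfold cesaroMean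
  rw [Submodule.coe_smul, h2, Pi.smul_apply, h1, smul_eq_mul, smul_eq_mul,
    Finset.sum_congr rfl fun k _ => h3 k, ← Finset.sum_mul, mul_assoc]

theorem tendsto_clm_rademacherMul (f : space p ω) (φ : space p ω →L[ℝ] ℝ) :
    Tendsto (fun n => φ (rademacherMul n f)) atTop (𝓝 0) := by
  refine tendsto_zero_of_cesaroMean
    (fun n hn => ⟨fun M => (M + 1) ^ 2, fun M => by positivity, ?_⟩) φ
  rw [tendsto_zero_iff_norm_tendsto_zero]
  refine tendsto_norm_of_tendsto_enorm (v := 0) ENNReal.zero_ne_top ?_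
  refine tendsto_lnorm_zero_of_dominated hp.out (fun M => aemeasurable_abs _)
    (G := fun t => ENNReal.ofReal |(f : L0 l) t|) f.2 (fun M => ?_) ?_
  · filter_upwards [coeFn_cesaroMean_rademacherMul n ((M + 1) ^ 2) f] with t ht
    rw [ht, abs_mul]
    exact ENNReal.ofReal_le_ofReal
      (mul_le_of_le_one_left (abs_nonneg _) (abs_cesaroMean_rademacher_le n _ t))
  · filter_upwards [ae_all_iff.2 fun M : ℕ => coeFn_cesaroMean_rademacherMul n ((M + 1) ^ 2) f,
      ae_restrict_of_ae (tendsto_cesaroMean_rademacher hn)] with t h1 h2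
    simp only [h1]
    have := ENNReal.tendsto_ofReal ((h2.mul_const ((f : L0 l) t)).abs)
    simpa using this

/-- If `σ = ±1` then `‖f + σ rₙ f‖ → ‖f‖`, where `rₙ` are the Rademacher functions. -/
theorem tendsto_norm_add_smul_rademacherMul (f : space p ω) {σ : ℝ} (hσ : |σ| = 1) :
    Tendsto (fun n => ‖f + σ • rademacherMul n f‖) atTop (𝓝 ‖f‖) := by
  refine tendsto_norm_of_tendsto_enorm (LT.lt.ne f.2) ?_
  have hone : ∀ n t, 0 ≤ 1 + σ * rademacher n t := fun n t => by
    have := neg_abs_le (σ * rademacher n t)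
    rw [abs_mul, hσ, abs_rademacher] at this
    linarith
  -- Since `1 + σ rₙ ≥ 0`, the absolute value becomes linear in `rₙ`.
  have hcoe : ∀ n, enorm p ω ((f + σ • rademacherMul n f : space p ω) : L0 l) =
      lnorm p ω fun t =>
        ENNReal.ofReal (|(f : L0 l) t| + σ * (|(f : L0 l) t| * rademacher n t)) := by
    intro n
    refine lnorm_congr hp.out ?_
    rw [Submodule.coe_add, Submodule.coe_smul]
    filter_upwards [coeFn_rademacherMul n f, AEEqFun.coeFn_smul σ (rademacherMul n f : L0 l),
      AEEqFun.coeFn_add (f : L0 l) (σ • (rademacherMul n f : L0 l))] with t h1 h2 h3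
    rw [h3, Pi.add_apply, h2, Pi.smul_apply, h1, smul_eq_mul]
    have : (f : L0 l) t + σ * (rademacher n t * (f : L0 l) t) =
      (1 + σ * rademacher n t) * (f : L0 l) t := by ring
    rw [this, abs_mul, abs_of_nonneg (hone n t)]
    ring_nf
  simp only [hcoe]
  have hG : lnorm p ω (fun t => 2 * ENNReal.ofReal |(f : L0 l) t|) < ∞ := by
    rw [lnorm_const_mul hp.out (by simp)]
    exact ENNReal.mul_lt_top (by simp) f.2
  refine tendsto_lnorm_of_dominated hp.out hG (fun n => Eventually.of_forall fun t => ?_) ?_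
  · have h2 : (2 : ℝ≥0∞) = ENNReal.ofReal 2 := by simp
    rw [h2, ← ENNReal.ofReal_mul (by norm_num)]
    refine ENNReal.ofReal_le_ofReal ?_
    have h3 : σ * rademacher n t ≤ 1 := by
      have := le_abs_self (σ * rademacher n t)
      rwa [abs_mul, hσ, abs_rademacher, one_mul] at this
    nlinarith [abs_nonneg ((f : L0 l) t)]
  · filter_upwards [ae_inner_lt_top hp.out f.2, ae_mem l] with x hx hxI
    have hm : AEStronglyMeasurable (fun t => |(f : L0 l) t|) (volume.restrict (Ioo 0 x)) :=
      (continuous_abs.comp_aestronglyMeasurable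
        (f : L0 l).aestronglyMeasurable).mono_measure (restrict_le hxI)
    have hi : IntegrableOn (fun t => |(f : L0 l) t|) (Ioo 0 x) :=
      ⟨hm, (hasFiniteIntegral_iff_ofReal (Eventually.of_forall fun t => abs_nonneg _)).2 hx⟩
    have hi2 : ∀ n, IntegrableOn (fun t => σ * (|(f : L0 l) t| * rademacher n t)) (Ioo 0 x) :=
      fun n => (hi.mul_bdd (c := 1) (measurable_rademacher _).aestronglyMeasurable
        (Eventually.of_forall fun t => by simp [abs_rademacher])).const_mul σ
    have heq : ∀ n, ∫⁻ t in Ioo 0 x,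
        ENNReal.ofReal (|(f : L0 l) t| + σ * (|(f : L0 l) t| * rademacher n t)) =
        ENNReal.ofReal ((∫ t in Ioo 0 x, |(f : L0 l) t|) +
          σ * ∫ t in Ioo 0 x, |(f : L0 l) t| * rademacher n t) := by
      intro n
      rw [← integral_const_mul, ← integral_add hi (hi2 n), ofReal_integral_eq_lintegral_ofReal]
      · exact hi.add (hi2 n)
      · refine Eventually.of_forall fun t => ?_
        have : |(f : L0 l) t| + σ * (|(f : L0 l) t| * rademacher n t) =
          (1 + σ * rademacher n t) * |(f : L0 l) t| := by ring
        simp only [Pi.zero_apply, this]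
        exact mul_nonneg (hone n t) (abs_nonneg _)
    simp only [heq]
    rw [← ofReal_integral_eq_lintegral_ofReal hi (Eventually.of_forall fun t => abs_nonneg _)]
    refine ENNReal.tendsto_ofReal ?_
    simpa using ((tendsto_integral_mul_rademacher hi).const_mul σ).const_add
      (∫ t in Ioo 0 x, |(f : L0 l) t|)

theorem tendsto_norm_add_rademacherMul (f : space p ω) :
    Tendsto (fun n => ‖f + rademacherMul n f‖) atTop (𝓝 ‖f‖) := by
  simpa using tendsto_norm_add_smul_rademacherMul f (σ := 1) (by simp)

theorem tendsto_norm_sub_rademacherMul (f : space p ω) :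
    Tendsto (fun n => ‖f - rademacherMul n f‖) atTop (𝓝 ‖f‖) := by
  simpa [sub_eq_add_neg] using tendsto_norm_add_smul_rademacherMul f (σ := -1) (by simp)

theorem isWASQ_space : IsWASQ (space p ω) := fun f hf =>
  ⟨fun n => rademacherMul n f, fun n => by rw [norm_rademacherMul, hf],
    hf ▸ tendsto_norm_add_rademacherMul f, hf ▸ tendsto_norm_sub_rademacherMul f,
    by simp only [norm_rademacherMul, hf, tendsto_const_nhds_iff],
    tendsto_clm_rademacherMul f⟩

end space
end Cesaro

/-! ### Failure of almost squareness -/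

namespace Cesaro

variable {p : ℝ} {l : EReal} {ω : Weight l}

section space

variable [hp : Fact (1 ≤ p)]

/-- The part of `yₙ` outside of the support of `x` tends to `0` if `‖x ± yₙ‖ → ‖x‖`. -/
theorem tendsto_lnorm_off_support {x : space p ω} {y : ℕ → space p ω}
    (hadd : Tendsto (fun n => ‖x + y n‖) atTop (𝓝 ‖x‖))
    (hsub : Tendsto (fun n => ‖x - y n‖) atTop (𝓝 ‖x‖)) :
    Tendsto (fun n => lnorm p ω fun t =>
      if (x : L0 l) t = 0 then ENNReal.ofReal |(y n : L0 l) t| else 0) atTop (𝓝 0) := by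
  have h0 : 0 < p := by linarith [hp.out]
  set a : ℕ → ℝ≥0∞ := fun n => lnorm p ω fun t =>
      if (x : L0 l) t = 0 then ENNReal.ofReal |(y n : L0 l) t| else 0 with ha
  set m : ℕ → ℝ≥0∞ := fun n => 2⁻¹ * (enorm p ω ((x + y n : space p ω) : L0 l) +
    enorm p ω ((x - y n : space p ω) : L0 l)) with hm
  have hX : enorm p ω (x : L0 l) ^ p ≠ ∞ := ENNReal.rpow_ne_top_of_nonneg h0.le (LT.lt.ne x.2)
  have hmlim : Tendsto m atTop (𝓝 (enorm p ω (x : L0 l))) := by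
    have h1 := ((tendsto_enorm_of_tendsto_norm hadd).add (tendsto_enorm_of_tendsto_norm hsub))
    rw [ofReal_norm, ← two_mul] at h1
    have h2 := ENNReal.Tendsto.const_mul (a := 2⁻¹) h1 (Or.inr (by simp))
    rwa [← mul_assoc, ENNReal.inv_mul_cancel (by simp) (by simp), one_mul] at h2
  -- The mean of `|x + y|` and `|x - y|` is `max |x| |y|`, which dominates `|x|` plus the
  -- restriction of `|y|` to `{x = 0}`. These two pieces are separated by superadditivity.
  have hle : ∀ n, enorm p ω (x : L0 l) ^ p + a n ^ p ≤ m n ^ p := by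
    intro n
    refine (lnorm_rpow_add_le hp.out (aemeasurable_abs _)).trans
      (ENNReal.rpow_le_rpow ?_ h0.le)
    simp only [hm]
    rw [← ENNReal.mul_le_iff_le_inv (by simp) (by simp), ← lnorm_const_mul hp.out (by simp)]
    refine le_trans (lnorm_mono hp.out ?_) (lnorm_add_le hp.out (aemeasurable_abs _))
    rw [Submodule.coe_add, Submodule.coe_sub]
    filter_upwards [AEEqFun.coeFn_add (x : L0 l) (y n : L0 l),
      AEEqFun.coeFn_sub (x : L0 l) (y n : L0 l)] with t h1 h2
    rw [h1, h2, Pi.add_apply, Pi.sub_apply, ← ENNReal.ofReal_add (abs_nonneg _) (abs_nonneg _)]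
    have h3 : (2 : ℝ≥0∞) = ENNReal.ofReal 2 := by simp
    split_ifs with hx
    · rw [hx, abs_zero, ENNReal.ofReal_zero, zero_add, h3, ← ENNReal.ofReal_mul (by norm_num)]
      refine ENNReal.ofReal_le_ofReal ?_
      rw [zero_add, zero_sub, abs_neg, two_mul]
    · rw [add_zero, h3, ← ENNReal.ofReal_mul (by norm_num)]
      refine ENNReal.ofReal_le_ofReal ?_
      have := abs_add_le ((x : L0 l) t + (y n : L0 l) t) ((x : L0 l) t - (y n : L0 l) t)
      have h4 : (x : L0 l) t + (y n : L0 l) t + ((x : L0 l) t - (y n : L0 l) t) =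
        2 * (x : L0 l) t := by ring
      rwa [h4, abs_mul, abs_two] at this
  have hmp : Tendsto (fun n => m n ^ p - enorm p ω (x : L0 l) ^ p) atTop (𝓝 0) := by
    have := ENNReal.Tendsto.sub (((ENNReal.continuous_rpow_const (y := p)).tendsto _).comp hmlim)
      (tendsto_const_nhds (x := enorm p ω (x : L0 l) ^ p)) (Or.inl hX)
    rwa [tsub_self] at this
  have hap : Tendsto (fun n => a n ^ p) atTop (𝓝 0) :=
    tendsto_of_tendsto_of_tendsto_of_le_of_le tendsto_const_nhds hmp (fun _ => bot_le)
      fun n => ENNReal.le_sub_of_add_le_left hX (hle n)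
  have := ((ENNReal.continuous_rpow_const (y := 1 / p)).tendsto _).comp hap
  rw [ENNReal.zero_rpow_of_pos (by positivity)] at this
  refine this.congr fun n => ?_
  simp only [Function.comp]
  rw [← ENNReal.rpow_mul, mul_one_div_cancel h0.ne', ENNReal.rpow_one]

theorem not_isASQ_of_disjoint {x₁ x₂ : space p ω} (h₁ : ‖x₁‖ = 1) (h₂ : ‖x₂‖ = 1)
    (hdisj : ∀ᵐ t ∂(vol l), (x₁ : L0 l) t = 0 ∨ (x₂ : L0 l) t = 0) :
    ¬ IsASQ (space p ω) := by
  intro h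
  obtain ⟨y, -, hxy, hy⟩ := h {x₁, x₂} (by simp) (by simp [h₁, h₂])
  have k₁ := tendsto_lnorm_off_support (h₁.symm ▸ (hxy x₁ (by simp)).1)
    (h₁.symm ▸ (hxy x₁ (by simp)).2)
  have k₂ := tendsto_lnorm_off_support (h₂.symm ▸ (hxy x₂ (by simp)).1)
    (h₂.symm ▸ (hxy x₂ (by simp)).2)
  have hle : ∀ n, enorm p ω (y n : L0 l) ≤
      (lnorm p ω fun t => if (x₁ : L0 l) t = 0 then ENNReal.ofReal |(y n : L0 l) t| else 0) +
      lnorm p ω fun t => if (x₂ : L0 l) t = 0 then ENNReal.ofReal |(y n : L0 l) t| else 0 := by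
    intro n
    refine le_trans (lnorm_mono hp.out ?_) (lnorm_add_le hp.out ?_)
    -- At almost every point one of `x₁`, `x₂` vanishes, so the two off-support parts together cover
    -- `y n`.
    · filter_upwards [hdisj] with t ht
      rcases ht with ht | ht <;> simp [ht]
    · have hs : NullMeasurableSet {t | (x₁ : L0 l) t = 0} (vol l) :=
        nullMeasurableSet_eq_fun (x₁ : L0 l).aestronglyMeasurable.aemeasurable aemeasurable_const
      exact (aemeasurable_abs (y n : L0 l)).indicator₀ hs
  have k := k₁.add k₂
  rw [add_zero] at k
  have hz := tendsto_of_tendsto_of_tendsto_of_le_of_le tendsto_const_nhds k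
    (fun _ => bot_le) hle
  have := tendsto_nhds_unique hz (tendsto_enorm_of_tendsto_norm hy)
  simp at this

theorem not_isASQ_space : ¬ IsASQ (space p ω) := by
  intro h
  -- The empty set is used to produce a nonzero vector, which also disposes of the case of a trivial
  -- space.
  obtain ⟨y, -, -, hy⟩ := h ∅ finite_empty (by simp)
  obtain ⟨k, hk⟩ := (hy.eventually_ne one_ne_zero).exists
  set f := y k
  obtain ⟨n, hn₁, hn₂⟩ := (((tendsto_norm_add_rademacherMul f).eventually_ne hk).and
    ((tendsto_norm_sub_rademacherMul f).eventually_ne hk)).exists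
  refine not_isASQ_of_disjoint (x₁ := ‖f + rademacherMul n f‖⁻¹ • (f + rademacherMul n f))
    (x₂ := ‖f - rademacherMul n f‖⁻¹ • (f - rademacherMul n f)) ?_ ?_ ?_ h
  · rw [norm_smul, norm_inv, norm_norm, inv_mul_cancel₀ hn₁]
  · rw [norm_smul, norm_inv, norm_norm, inv_mul_cancel₀ hn₂]
  · simp only [Submodule.coe_smul, Submodule.coe_add, Submodule.coe_sub]
    filter_upwards [coeFn_rademacherMul n f,
      AEEqFun.coeFn_smul ‖f + rademacherMul n f‖⁻¹ ((f : L0 l) + (rademacherMul n f : L0 l)),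
      AEEqFun.coeFn_smul ‖f - rademacherMul n f‖⁻¹ ((f : L0 l) - (rademacherMul n f : L0 l)),
      AEEqFun.coeFn_add (f : L0 l) (rademacherMul n f : L0 l),
      AEEqFun.coeFn_sub (f : L0 l) (rademacherMul n f : L0 l)] with t h1 h2 h3 h4 h5
    rw [h2, h3, Pi.smul_apply, Pi.smul_apply, h4, h5, Pi.add_apply, Pi.sub_apply, h1]
    rcases rademacher_eq_or n t with hr | hr <;> simp [hr]

end space
end Cesaro

/-! ### Series with bounded signed partial sums and copies of `c₀` -/

/-- A minorant of the mean of `|s + ∑ ±aₙ|` over all signs, where `v = ∑ aₙ²`. -/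
def khinchineMinorant (c s v : ℝ) : ℝ :=
  (s ^ 2 + v) / c - (s ^ 4 + 6 * s ^ 2 * v + 3 * v ^ 2) / (4 * c ^ 3)

theorem khinchineMinorant_zero_le {c : ℝ} (hc : 0 < c) (s : ℝ) :
    khinchineMinorant c s 0 ≤ |s| := by
  -- Homogeneity reduces the claim to `w ^ 2 - w ^ 4 / 4 ≤ w` for `w ≥ 0`.
  obtain ⟨w, hw⟩ : ∃ w, |s| = c * w := ⟨|s| / c, by field_simp⟩
  have hw0 : 0 ≤ w := by
    by_contra! h
    have := abs_nonneg s
    rw [hw] at this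
    nlinarith
  have h2 : s ^ 2 = (c * w) ^ 2 := by rw [← hw, sq_abs]
  have h4 : s ^ 4 = (c * w) ^ 4 := by
    rw [show s ^ 4 = (s ^ 2) ^ 2 by ring, h2]; ring
  have : khinchineMinorant c s 0 = c * (w ^ 2 - w ^ 4 / 4) := by
    unfold khinchineMinorant
    rw [h2, h4]
    field_simp
    ring
  rw [this, hw]
  refine mul_le_mul_of_nonneg_left ?_ hc.le
  have h5 : 0 ≤ w ^ 3 / 4 + 1 - w := by
    -- The cubic is smallest at `2 / √3`; the rational `7 / 6` is close enough to it.
    nlinarith [mul_nonneg (by linarith : 0 ≤ w + 7 / 3) (sq_nonneg (w - 7 / 6))]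
  nlinarith [mul_nonneg hw0 h5]

/-- Averaging over the sign of `a` turns `s ^ 2` into `s ^ 2 + a ^ 2` exactly. In the quartic term
`3 v ^ 2` overestimates the true fourth moment, leaving a surplus `a ^ 4 / (2 * c ^ 3)` of the right
sign. -/
theorem khinchineMinorant_add_sq_le {c : ℝ} (hc : 0 < c) (s a v : ℝ) :
    khinchineMinorant c s (v + a ^ 2) ≤
      (khinchineMinorant c (s + a) v + khinchineMinorant c (s - a) v) / 2 := by
  have : (khinchineMinorant c (s + a) v + khinchineMinorant c (s - a) v) / 2 -
      khinchineMinorant c s (v + a ^ 2) = a ^ 4 / (2 * c ^ 3) := by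
    unfold khinchineMinorant
    field_simp
    ring
  have h2 : 0 ≤ a ^ 4 / (2 * c ^ 3) := by positivity
  linarith

theorem khinchineMinorant_sqrt {v : ℝ} (hv : 0 < v) :
    khinchineMinorant √v 0 v = √v / 4 := by
  have h : v = √v ^ 2 := (Real.sq_sqrt hv.le).symm
  have h0 : 0 < √v := Real.sqrt_pos.2 hv
  generalize √v = c at *
  subst h
  unfold khinchineMinorant
  field_simp
  ring

namespace Cesaro

variable {p : ℝ} {l : EReal} {ω : Weight l} [hp : Fact (1 ≤ p)]

/-- Here `g` is the mean of `|z + ∑ ±xₖ|` over all signs, built by absorbing `±x N` into `z`; the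
triangle inequality bounds its norm. It does not depend on `c`, so `c` may later vary with `t`. -/
theorem exists_khinchineMinorant_le (x : ℕ → space p ω) (C : ℝ≥0∞) (N : ℕ) (z : space p ω)
    (hz : ∀ ε : ℕ → ℝ, (∀ n, |ε n| = 1) →
      enorm p ω ((z + ∑ k ∈ Finset.range N, ε k • x k : space p ω) : L0 l) ≤ C) :
    ∃ g : ℝ → ℝ≥0∞, AEMeasurable g (vol l) ∧ lnorm p ω g ≤ C ∧ ∀ᵐ t ∂(vol l), ∀ c > 0,
      ENNReal.ofReal (khinchineMinorant c ((z : L0 l) t)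
        (∑ k ∈ Finset.range N, (x k : L0 l) t ^ 2)) ≤ g t := by
  induction N generalizing z with
  | zero =>
    refine ⟨fun t => ENNReal.ofReal |(z : L0 l) t|, aemeasurable_abs _, ?_,
      Eventually.of_forall fun t c hc => ?_⟩
    · change enorm p ω (z : L0 l) ≤ C
      simpa using hz (fun _ => 1) (by simp)
    · exact ENNReal.ofReal_le_ofReal (by simpa using khinchineMinorant_zero_le hc _)
  | succ N ih =>
    have key : ∀ σ : ℝ, |σ| = 1 → ∀ ε : ℕ → ℝ, (∀ n, |ε n| = 1) →
        enorm p ω (((z + σ • x N) + ∑ k ∈ Finset.range N, ε k • x k : space p ω) : L0 l) ≤ C := by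
      intro σ hσ ε hε
      convert hz (Function.update ε N σ) (fun n => ?_) using 3
      · rw [Finset.sum_range_succ, Function.update_self, add_assoc, add_comm (σ • x N)]
        congr 2
        refine Finset.sum_congr rfl fun k hk => ?_
        rw [Function.update_of_ne (Finset.mem_range.1 hk).ne]
      · rcases eq_or_ne n N with rfl | h
        · rwa [Function.update_self]
        · rw [Function.update_of_ne h, hε]
    obtain ⟨g₁, hm₁, hC₁, hg₁⟩ := ih _ (key 1 (by simp))
    obtain ⟨g₂, hm₂, hC₂, hg₂⟩ := ih _ (key (-1) (by simp))
    refine ⟨fun t => 2⁻¹ * (g₁ t + g₂ t), (hm₁.add hm₂).const_mul _, ?_, ?_⟩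
    · rw [lnorm_const_mul hp.out (by simp)]
      refine (mul_le_mul_right ((lnorm_add_le hp.out hm₁).trans (add_le_add hC₁ hC₂)) _).trans ?_
      rw [← two_mul, ← mul_assoc, ENNReal.inv_mul_cancel (by simp) (by simp), one_mul]
    · simp only [one_smul, neg_smul, ← sub_eq_add_neg, Submodule.coe_add, Submodule.coe_sub]
        at hg₁ hg₂
      filter_upwards [hg₁, hg₂, AEEqFun.coeFn_add (z : L0 l) (x N : L0 l),
        AEEqFun.coeFn_sub (z : L0 l) (x N : L0 l)] with t h1 h2 h3 h4 c hc
      have k1 := h1 c hc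
      have k2 := h2 c hc
      rw [h3, Pi.add_apply] at k1
      rw [h4, Pi.sub_apply] at k2
      rw [← ENNReal.mul_le_iff_le_inv (by simp) (by simp)]
      have h5 : (2 : ℝ≥0∞) = ENNReal.ofReal 2 := by simp
      rw [h5, ← ENNReal.ofReal_mul (by norm_num)]
      refine le_trans (ENNReal.ofReal_le_ofReal ?_) (ENNReal.ofReal_add_le.trans (add_le_add k1 k2))
      have := khinchineMinorant_add_sq_le hc ((z : L0 l) t) ((x N : L0 l) t)
        (∑ k ∈ Finset.range N, (x k : L0 l) t ^ 2)
      rw [Finset.sum_range_succ]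
      linarith

theorem lnorm_sqrt_sum_sq_le {x : ℕ → space p ω} {C : ℝ≥0∞} {N : ℕ}
    (hx : ∀ ε : ℕ → ℝ, (∀ n, |ε n| = 1) →
      enorm p ω ((∑ k ∈ Finset.range N, ε k • x k : space p ω) : L0 l) ≤ C) :
    lnorm p ω (fun t => ENNReal.ofReal √(∑ k ∈ Finset.range N, (x k : L0 l) t ^ 2)) ≤ 4 * C := by
  obtain ⟨g, -, hC, hg⟩ := exists_khinchineMinorant_le x C N 0 (by simpa using hx)
  refine le_trans (lnorm_mono hp.out (h := fun t => 4 * g t) ?_) ?_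
  · filter_upwards [hg, AEEqFun.coeFn_zero (α := ℝ) (β := ℝ) (μ := vol l)] with t ht h0
    rcases (Finset.sum_nonneg fun k _ => sq_nonneg _ :
      0 ≤ ∑ k ∈ Finset.range N, (x k : L0 l) t ^ 2).eq_or_lt with hv | hv
    · simp [← hv]
    -- The choice `c = √v`, made pointwise in `t`, gives the value `√v / 4`, whence the constant
    -- `4`.
    · have := ht _ (Real.sqrt_pos.2 hv)
      rw [Submodule.coe_zero, h0, Pi.zero_apply, khinchineMinorant_sqrt hv] at this
      refine le_trans (le_of_eq ?_) (mul_le_mul_right this 4)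
      have h4 : (4 : ℝ≥0∞) = ENNReal.ofReal 4 := by simp
      rw [h4, ← ENNReal.ofReal_mul (by norm_num)]
      congr 1
      ring
  · rw [lnorm_const_mul hp.out (by simp)]
    exact mul_le_mul_right hC _

/-- The terms of a series in `C_{p,ω}` with bounded signed partial sums tend to `0`. -/
theorem tendsto_zero_of_bounded_sign_sums {x : ℕ → space p ω} {C : ℝ}
    (hx : ∀ (N : ℕ) (ε : ℕ → ℝ), (∀ n, |ε n| = 1) → ‖∑ k ∈ Finset.range N, ε k • x k‖ ≤ C) :
    Tendsto x atTop (𝓝 0) := by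
  set g : ℕ → ℝ → ℝ≥0∞ := fun N t =>
    ENNReal.ofReal √(∑ k ∈ Finset.range N, (x k : L0 l) t ^ 2) with hg
  have hgm : ∀ N, AEMeasurable (g N) (vol l) := fun N =>
    (Finset.aemeasurable_fun_sum _ fun k _ =>
      ((x k : L0 l).aestronglyMeasurable.aemeasurable.pow_const 2)).sqrt.ennreal_ofReal
  have hmono : ∀ t, Monotone fun N => g N t := fun t => monotone_nat_of_le_succ fun N =>
    ENNReal.ofReal_le_ofReal (Real.sqrt_le_sqrt (by
      rw [Finset.sum_range_succ]; exact le_add_of_nonneg_right (sq_nonneg _)))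
  have hfin : lnorm p ω (fun t => ⨆ N, g N t) < ∞ := by
    rw [lnorm_iSup hp.out hgm hmono]
    refine lt_of_le_of_lt (iSup_le fun N => lnorm_sqrt_sum_sq_le (C := ENNReal.ofReal C)
      fun ε hε => ?_) (ENNReal.mul_lt_top (by simp) ENNReal.ofReal_lt_top)
    rw [← ofReal_norm]
    exact ENNReal.ofReal_le_ofReal (hx N ε hε)
  rw [tendsto_zero_iff_norm_tendsto_zero]
  refine tendsto_norm_of_tendsto_enorm (v := 0) ENNReal.zero_ne_top ?_
  refine tendsto_lnorm_zero_of_dominated hp.out (fun n => aemeasurable_abs _) hfin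
    (fun n => Eventually.of_forall fun t => ?_) ?_
  -- The partial sum of length `n + 1` is the first to contain the term of index `n`.
  · refine le_trans (ENNReal.ofReal_le_ofReal ?_) (le_iSup (fun N => g N t) (n + 1))
    rw [← Real.sqrt_sq_eq_abs]
    refine Real.sqrt_le_sqrt ?_
    rw [Finset.sum_range_succ]
    exact le_add_of_nonneg_left (Finset.sum_nonneg fun k _ => sq_nonneg _)
  · filter_upwards [ae_lt_top_of_lnorm hp.out (AEMeasurable.iSup hgm) hfin] with t ht
    have hsum : Summable fun k => (x k : L0 l) t ^ 2 := by
      refine summable_of_sum_range_le (c := (⨆ N, g N t).toReal ^ 2) (fun k => sq_nonneg _)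
        fun N => ?_
      rw [← Real.sqrt_le_left ENNReal.toReal_nonneg]
      exact (ENNReal.ofReal_le_iff_le_toReal ht.ne).1 (le_iSup (fun N => g N t) N)
    have h1 := hsum.tendsto_atTop_zero.sqrt
    simp only [Real.sqrt_sq_eq_abs, Real.sqrt_zero] at h1
    simpa using ENNReal.tendsto_ofReal h1

end Cesaro

/-- The `n`-th unit vector of `c₀`. -/
def c0Single (n : ℕ) : C₀(ℕ, ℝ) where
  toFun := Pi.single n 1
  continuous_toFun := continuous_of_discreteTopology
  zero_at_infty' := by
    refine tendsto_const_nhds.congr' ?_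
    rw [cocompact_eq_cofinite]
    filter_upwards [(finite_singleton n).compl_mem_cofinite] with k hk
    exact (Pi.single_eq_of_ne (M := fun _ : ℕ => ℝ) hk 1).symm

theorem c0Single_apply (n k : ℕ) : c0Single n k = if k = n then 1 else 0 :=
  Pi.single_apply n 1 k

theorem norm_sum_smul_c0Single_le {ε : ℕ → ℝ} (hε : ∀ n, |ε n| = 1) (N : ℕ) :
    ‖∑ k ∈ Finset.range N, ε k • c0Single k‖ ≤ 1 := by
  rw [← ZeroAtInftyContinuousMap.norm_toBCF_eq_norm,
    BoundedContinuousFunction.norm_le zero_le_one]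
  intro j
  have h : (∑ k ∈ Finset.range N, ε k • c0Single k) j =
      ∑ k ∈ Finset.range N, ε k * c0Single k j := by
    induction N with
    | zero => simp
    | succ N ih =>
      rw [Finset.sum_range_succ, Finset.sum_range_succ, ZeroAtInftyContinuousMap.add_apply, ih,
        ZeroAtInftyContinuousMap.smul_apply, smul_eq_mul]
  change ‖(∑ k ∈ Finset.range N, ε k • c0Single k) j‖ ≤ 1
  rw [h]
  simp only [c0Single_apply, mul_ite, mul_one, mul_zero, Finset.sum_ite_eq]
  split_ifs <;> simp [hε]

theorem not_tendsto_c0Single : ¬ Tendsto c0Single atTop (𝓝 0) := by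
  intro h
  have h1 : ∀ n, 1 ≤ ‖c0Single n‖ := fun n => by
    rw [← ZeroAtInftyContinuousMap.norm_toBCF_eq_norm]
    refine le_trans (le_of_eq ?_) ((c0Single n).toBCF.norm_coe_le_norm n)
    change 1 = ‖c0Single n n‖
    simp [c0Single_apply]
  have := ge_of_tendsto h.norm (Eventually.of_forall h1)
  simp at this
  linarith

theorem Cesaro.not_containsCopyOfC0_space {p : ℝ} [Fact (1 ≤ p)] {l : EReal}
    {ω : Cesaro.Weight l} : ¬ ContainsCopyOfC0 (Cesaro.space p ω) := by
  rintro ⟨Y, ⟨T⟩⟩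
  have h : Tendsto (fun n => ((T (c0Single n) : Y) : Cesaro.space p ω)) atTop (𝓝 0) := by
    refine Cesaro.tendsto_zero_of_bounded_sign_sums
      (C := ‖(T : C₀(ℕ, ℝ) →L[ℝ] Y)‖) fun N ε hε => ?_
    have h1 : ∑ k ∈ Finset.range N, ε k • ((T (c0Single k) : Y) : Cesaro.space p ω) =
        (T (∑ k ∈ Finset.range N, ε k • c0Single k) : Y) := by
      simp [map_sum]
    rw [h1]
    exact (T : C₀(ℕ, ℝ) →L[ℝ] Y).unit_le_opNorm _ (norm_sum_smul_c0Single_le hε N)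
  have h2 : Tendsto (fun n => T (c0Single n)) atTop (𝓝 0) := tendsto_subtype_rng.2 h
  have h3 := (T.symm.continuous.tendsto 0).comp h2
  simp only [Function.comp_def, ContinuousLinearEquiv.symm_apply_apply, map_zero] at h3
  exact not_tendsto_c0Single h3

/-! ### `L₁[0,1]` as a weighted Cesàro space -/

theorem IsWASQ.of_linearIsometryEquiv {X Y : Type*} [NormedAddCommGroup X] [NormedSpace ℝ X]
    [CompleteSpace X] [NormedAddCommGroup Y] [NormedSpace ℝ Y] [CompleteSpace Y]
    (e : X ≃ₗᵢ[ℝ] Y) (h : IsWASQ X) : IsWASQ Y := by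
  intro x hx
  obtain ⟨y, hy, hadd, hsub, hnorm, hweak⟩ := h (e.symm x) (by rwa [e.symm.norm_map])
  refine ⟨fun n => e (y n), fun n => by rw [e.norm_map]; exact hy n, ?_, ?_,
    by simpa only [e.norm_map] using hnorm,
    fun φ => hweak (φ.comp (e : X →L[ℝ] Y))⟩
  · refine hadd.congr fun n => ?_
    rw [← e.norm_map, map_add, e.apply_symm_apply]
  · refine hsub.congr fun n => ?_
    rw [← e.norm_map, map_sub, e.apply_symm_apply]

theorem IsASQ.of_linearIsometryEquiv {X Y : Type*} [NormedAddCommGroup X] [NormedSpace ℝ X]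
    [CompleteSpace X] [NormedAddCommGroup Y] [NormedSpace ℝ Y] [CompleteSpace Y]
    (e : X ≃ₗᵢ[ℝ] Y) (h : IsASQ X) : IsASQ Y := by
  intro s hs hs1
  obtain ⟨y, hy, hxy, hnorm⟩ := h (e.symm '' s) (hs.image _) (by
    rintro _ ⟨x, hx, rfl⟩
    rw [e.symm.norm_map, hs1 x hx])
  refine ⟨fun n => e (y n), fun n => by rw [e.norm_map]; exact hy n, fun x hx => ?_,
    by simpa only [e.norm_map] using hnorm⟩
  obtain ⟨hadd, hsub⟩ := hxy _ (mem_image_of_mem _ hx)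
  constructor
  · refine hadd.congr fun n => ?_
    rw [← e.norm_map, map_add, e.apply_symm_apply]
  · refine hsub.congr fun n => ?_
    rw [← e.norm_map, map_sub, e.apply_symm_apply]

namespace Cesaro

theorem interval_one : interval 1 = Ioo 0 1 := by
  ext x
  simp only [interval, mem_ofPred_eq, mem_Ioo, ← EReal.coe_one, EReal.coe_lt_coe_iff]

theorem vol_one : vol 1 = volume.restrict (Icc 0 1) := by
  rw [vol, interval_one, restrict_Ioo_eq_restrict_Icc]

theorem lintegral_one_div_Ioo {t : ℝ} (ht : t ∈ Ioo (0 : ℝ) 1) :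
    ∫⁻ x in Ioo t 1, ENNReal.ofReal (1 / x) = ENNReal.ofReal (-Real.log t) := by
  rw [restrict_Ioo_eq_restrict_Ioc, ← ofReal_integral_eq_lintegral_ofReal,
    ← intervalIntegral.integral_of_le ht.2.le, integral_one_div_of_pos ht.1 one_pos, one_div,
    Real.log_inv]
  · rw [← IntegrableOn, ← intervalIntegrable_iff_integrableOn_Ioc_of_le ht.2.le]
    refine intervalIntegral.intervalIntegrable_one_div (fun x hx => ?_) continuousOn_id
    rw [uIcc_of_le ht.2.le] at hx
    exact (ht.1.trans_le hx.1).ne'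
  · filter_upwards [ae_restrict_mem measurableSet_Ioc] with x hx
    exact one_div_nonneg.2 (ht.1.trans hx.1).le

/-- Tonelli on the triangle `t < x`: the weight that `g t` receives is `∫ 1/x` over `(t, 1)`, that
is `-log t`. -/
theorem lnorm_one_invWeight {g : ℝ → ℝ≥0∞} (hg : AEMeasurable g (vol 1)) :
    lnorm 1 invWeight g = ∫⁻ t, ENNReal.ofReal (-Real.log t) * g t ∂(vol 1) := by
  -- A measurable representative of `g` makes the integrand jointly measurable, as the swap of
  -- integrals requires.
  rw [lnorm_congr le_rfl hg.ae_eq_mk, lintegral_congr_ae (g := fun t =>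
    ENNReal.ofReal (-Real.log t) * hg.mk g t) (by filter_upwards [hg.ae_eq_mk] with t ht; rw [ht])]
  have hm := hg.measurable_mk
  generalize hg.mk g = G at hm
  have h1 : lnorm 1 invWeight G = ∫⁻ x, ∫⁻ t, (if t < x then ENNReal.ofReal (1 / x) * G t else 0)
      ∂(vol 1) ∂(vol 1) := by
    simp only [lnorm, ENNReal.rpow_one, div_one]
    refine lintegral_congr_ae ?_
    filter_upwards [AEEqFun.coeFn_mk (μ := vol 1) (fun x : ℝ => 1 / x) (by
      simp only [one_div]; exact measurable_inv.aestronglyMeasurable), ae_mem 1] with x hx hxI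
    have h2 : invWeight.toL0 x = 1 / x := hx
    rw [interval_one] at hxI
    have h3 : Ioo 0 x = Iio x ∩ Ioo 0 1 := by
      ext t
      simp only [mem_Ioo, mem_inter_iff, mem_Iio]
      exact ⟨fun h => ⟨h.2, h.1, h.2.trans hxI.2⟩, fun h => ⟨h.2.1, h.1⟩⟩
    rw [h2, h3, ← Measure.restrict_restrict measurableSet_Iio, ← interval_one,
      ← lintegral_const_mul' _ _ ENNReal.ofReal_ne_top, ← lintegral_indicator measurableSet_Iio]
    rfl
  have : SFinite (vol 1) := by rw [vol]; infer_instance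
  rw [h1, lintegral_lintegral_swap]
  · refine lintegral_congr_ae ?_
    filter_upwards [ae_mem 1] with t ht
    rw [interval_one] at ht
    have h3 : Ioo t 1 = Ioi t ∩ Ioo 0 1 := by
      ext x
      simp only [mem_Ioo, mem_inter_iff, mem_Ioi]
      exact ⟨fun h => ⟨h.1, ht.1.trans h.1, h.2⟩, fun h => ⟨h.1, h.2.2⟩⟩
    rw [← lintegral_one_div_Ioo ht, h3, ← Measure.restrict_restrict measurableSet_Ioi,
      ← interval_one, ← lintegral_mul_const _ (by fun_prop),
      ← lintegral_indicator measurableSet_Ioi]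
    rfl
  · refine Measurable.aemeasurable ?_
    refine Measurable.ite (measurableSet_lt measurable_snd measurable_fst) ?_ measurable_const
    exact ((measurable_fst.const_div 1).ennreal_ofReal).mul (hm.comp measurable_snd)

/-- The function `-log` on `(0, 1)`. -/
def negLog : L0 1 := AEEqFun.mk (fun t => -Real.log t) (by fun_prop)

theorem coeFn_negLog : negLog =ᵐ[vol 1] fun t => -Real.log t := AEEqFun.coeFn_mk _ _

theorem eLpNorm_negLog_mul (f : L0 1) :
    eLpNorm (negLog * f : L0 1) 1 (vol 1) = enorm 1 invWeight f := by
  rw [eLpNorm_one_eq_lintegral_enorm, enorm, lnorm_one_invWeight (aemeasurable_abs f)]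
  refine lintegral_congr_ae ?_
  filter_upwards [AEEqFun.coeFn_mul negLog f, coeFn_negLog, ae_mem 1] with t h1 h2 ht
  rw [interval_one] at ht
  have h3 := Real.log_neg ht.1 ht.2
  rw [h1, Pi.mul_apply, h2, Real.enorm_eq_ofReal_abs, abs_mul, abs_of_nonneg (by linarith),
    ENNReal.ofReal_mul (by linarith)]

/-- The isometry `f ↦ -log · f` of `C_{1,1/x}(0,1)` into `L₁`. -/
def toL1 : space 1 invWeight →ₗᵢ[ℝ] Lp ℝ 1 (vol 1) where
  toFun f := ⟨negLog * (f : L0 1), by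
    rw [Lp.mem_Lp_iff_eLpNorm_lt_top, eLpNorm_negLog_mul]; exact f.2⟩
  map_add' f g := by
    refine Subtype.ext (AEEqFun.ext ?_)
    change (negLog * ((f : L0 1) + (g : L0 1)) : L0 1) =ᵐ[vol 1]
      (negLog * (f : L0 1) + negLog * (g : L0 1) : L0 1)
    filter_upwards [AEEqFun.coeFn_mul negLog ((f : L0 1) + (g : L0 1)),
      AEEqFun.coeFn_add (f : L0 1) (g : L0 1), AEEqFun.coeFn_mul negLog (f : L0 1),
      AEEqFun.coeFn_mul negLog (g : L0 1),
      AEEqFun.coeFn_add (negLog * (f : L0 1)) (negLog * (g : L0 1))] with t h1 h2 h3 h4 h5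
    rw [h1, h5, Pi.mul_apply, h2, Pi.add_apply, Pi.add_apply, h3, h4, Pi.mul_apply, Pi.mul_apply,
      mul_add]
  map_smul' c f := by
    refine Subtype.ext (AEEqFun.ext ?_)
    change (negLog * (c • (f : L0 1)) : L0 1) =ᵐ[vol 1] (c • (negLog * (f : L0 1)) : L0 1)
    filter_upwards [AEEqFun.coeFn_mul negLog (c • (f : L0 1)),
      AEEqFun.coeFn_smul c (f : L0 1), AEEqFun.coeFn_mul negLog (f : L0 1),
      AEEqFun.coeFn_smul c (negLog * (f : L0 1))] with t h1 h2 h3 h4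
    rw [h1, h4, Pi.mul_apply, h2, Pi.smul_apply, Pi.smul_apply, h3, Pi.mul_apply, mul_smul_comm]
  norm_map' f := congrArg ENNReal.toReal (eLpNorm_negLog_mul (f : L0 1))

/-- On `(0, 1)` the function `-log` is strictly positive, so division by it inverts the
multiplication. -/
theorem toL1_surjective : Function.Surjective toL1 := by
  intro g
  set f : L0 1 := AEEqFun.mk (fun t => (-Real.log t)⁻¹) (by fun_prop) * (g : L0 1) with hf
  have hfg : negLog * f = (g : L0 1) := by
    refine AEEqFun.ext ?_
    filter_upwards [AEEqFun.coeFn_mul negLog f, coeFn_negLog, ae_mem 1,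
      AEEqFun.coeFn_mul (AEEqFun.mk (fun t => (-Real.log t)⁻¹) (by fun_prop)) (g : L0 1),
      AEEqFun.coeFn_mk (μ := vol 1) (fun t => (-Real.log t)⁻¹) (by fun_prop)] with t h1 h2 ht h3 h4
    rw [interval_one] at ht
    have h5 := Real.log_neg ht.1 ht.2
    rw [h1, Pi.mul_apply, h2, hf, h3, Pi.mul_apply, h4, mul_inv_cancel_left₀ (by linarith)]
  refine ⟨⟨f, ?_⟩, Subtype.ext hfg⟩
  change enorm 1 invWeight f < ∞
  rw [← eLpNorm_negLog_mul, hfg]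
  exact Lp.mem_Lp_iff_eLpNorm_lt_top.1 g.2

end Cesaro

end

theorem mainTheorem8 :
    (∀ (p : ℝ) [Fact (1 ≤ p)] (l : EReal) (_ : 0 < l) (ω : Cesaro.Weight l),
      ¬ ContainsCopyOfC0 (Cesaro.space p ω) ∧
      IsWASQ (Cesaro.space p ω) ∧ ¬ IsASQ (Cesaro.space p ω)) ∧
    (Nonempty (Cesaro.space 1 Cesaro.invWeight ≃ₗᵢ[ℝ]
      Lp ℝ 1 ((volume : Measure ℝ).restrict (Icc 0 1))) ∧
    IsWASQ (Lp ℝ 1 ((volume : Measure ℝ).restrict (Icc 0 1))) ∧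
    ¬ IsASQ (Lp ℝ 1 ((volume : Measure ℝ).restrict (Icc 0 1)))) := by
  refine ⟨fun p _ l _ ω => ⟨Cesaro.not_containsCopyOfC0_space, Cesaro.isWASQ_space,
    Cesaro.not_isASQ_space⟩, ?_⟩
  rw [← Cesaro.vol_one]
  have e := LinearIsometryEquiv.ofSurjective Cesaro.toL1 Cesaro.toL1_surjective
  exact ⟨⟨e⟩, Cesaro.isWASQ_space.of_linearIsometryEquiv e,
    fun h => Cesaro.not_isASQ_space (h.of_linearIsometryEquiv e.symm)⟩
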